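/- Let $\mathbb{k}$ be an algebraically closed field of characteristic zero, let $l\ge 1$, and let $G=\mathbb{Z}_{m_1}\times\cdots\times\mathbb{Z}_{m_l}$ with positive integers $m_1\mid m_2\mid\cdots\mid m_l$ and with $g_r$ the standard generator of the factor $\mathbb{Z}_{m_r}$. Fix a primitive $m_l$-th root of unity $\zeta_{m_l}\in\mathbb{k}^*$ and put $\zeta_{m_r}=\zeta_{m_l}^{m_l/m_r}$. Let $(a_{rs})_{1\le r<s\le l}$ be integers (for instance $0\le a_{rs}<m_r$), and let $\omega$ be the normalized $2$-cocycle on $G$ with values in $\mathbb{k}^*$ (trivial action) $$\omega(g_1^{i_1}\cdots g_l^{i_l},\,g_1^{j_1}\cdots g_l^{j_l})=\prod_{1\le r<s\le l}\zeta_{m_r}^{-a_{rs}i_sj_r}\qquad(0\le i_r,j_r<m_r).$$ Let $G_0=\{x\in G : \omega(x,y)=\omega(y,x)\text{ for all }y\in G\}$ be the set of $\omega$-regular elements. Let $B=(b_{ij})$ be the antisymmetric integer $l\times l$ matrix with $b_{ij}=\frac{m_l}{m_i}a_{ij}$ for $i<j$, and let $\lambda_1\mid\cdots\mid\lambda_k$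 be its invariant factors, that is, positive integers such that $B=P\,\mathrm{diag}(\lambda_1,\dots,\lambda_k,0,\dots,0)\,Q$ with $P,Q\in GL_l(\mathbb{Z})$. Then $$|G_0|=\frac{|G|}{\prod_{i=1}^k\frac{m_l}{(m_l,\lambda_i)}}.$$ Moreover, an $\omega$-projective representation of $G$ being a map $\rho:G\to GL(V)$ with $\rho(1)=1$ and $\rho(x)\rho(y)=\omega(x,y)\rho(xy)$, irreducible $\omega$-projective representations exist, and every one of them is finite-dimensional of dimension $$d=\sqrt{\prod_{i=1}^k\frac{m_l}{(m_l,\lambda_i)}}.$$ -/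

import Mathlib

/-- A normalized 2-cocycle on an additively written group `G` with values in the multiplicative
group of `K`, on which `G` acts trivially. -/
structure NormalizedTwoCocycle (G : Type*) [AddGroup G] (K : Type*) [Field K] where
  toFun : G → G → Kˣ
  cocycle : ∀ x y z : G, toFun y z * toFun x (y + z) = toFun (x + y) z * toFun x y
  zero_left : ∀ x : G, toFun 0 x = 1
  zero_right : ∀ x : G, toFun x 0 = 1

/-- The set of `ω`-regular elements: `ω(x, y) = ω(y, x)` for all `y` (for an abelian group). -/
def NormalizedTwoCocycle.regularElements {G : Type*} [AddCommGroup G] {K : Type*} [Field K]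
    (ω : NormalizedTwoCocycle G K) : Set G :=
  {x | ∀ y : G, ω.toFun x y = ω.toFun y x}

/-- An `ω`-projective representation of `G` on the `K`-vector space `V`: a map `ρ : G → GL(V)`
with `ρ(1) = 1` and `ρ(x) ρ(y) = ω(x, y) ρ(xy)`, the group being written additively. -/
structure ProjectiveRep {G : Type*} [AddGroup G] {K : Type*} [Field K]
    (ω : NormalizedTwoCocycle G K) (V : Type*) [AddCommGroup V] [Module K V] where
  toFun : G → (V ≃ₗ[K] V)
  map_zero : ∀ v : V, toFun 0 v = v
  map_mul : ∀ (x y : G) (v : V),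
    toFun x (toFun y v) = (ω.toFun x y : K) • toFun (x + y) v

/-- `ρ` is irreducible: `V` is nonzero and its only invariant subspaces are `0` and `V`. -/
def ProjectiveRep.IsIrreducible {G : Type*} [AddGroup G] {K : Type*} [Field K]
    {ω : NormalizedTwoCocycle G K} {V : Type*} [AddCommGroup V] [Module K V]
    (ρ : ProjectiveRep ω V) : Prop :=
  Nontrivial V ∧
    ∀ W : Submodule K V, (∀ (x : G), ∀ v ∈ W, ρ.toFun x v ∈ W) → W = ⊥ ∨ W = ⊤

/-- The function `(x, y) ↦ ∏_{r < s} ζ_{m_r} ^ (- a_{rs} x_s y_r)` on `∏ ℤ/m_i`, the coordinates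
of `x` and `y` being represented in `[0, m_i)`, where `ζ_{m_r} = ζ ^ (m_l / m_r)` and `m_l` is the
last of the moduli. -/
def abelianCocycleFun {n : ℕ} (m : Fin (n + 1) → ℕ) {K : Type*} [Field K] (ζ : Kˣ)
    (a : Fin (n + 1) → Fin (n + 1) → ℤ) (x y : ∀ i, ZMod (m i)) : Kˣ :=
  ∏ r : Fin (n + 1), ∏ s ∈ Finset.Ioi r,
    (ζ ^ (m (Fin.last n) / m r)) ^ (-(a r s * ((x s).val : ℤ) * ((y r).val : ℤ)))

theorem zpow_eq_of_intModEq {H : Type*} [Group H] {η : H} {N : ℕ} (h : η ^ N = 1) {A B : ℤ}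
    (hAB : A ≡ B [ZMOD N]) : η ^ A = η ^ B := by
  obtain ⟨c, hc⟩ := hAB.dvd
  have : B = A + N * c := by linarith
  rw [this, zpow_add, zpow_mul, zpow_natCast, h, one_zpow, mul_one]

theorem val_add_intModEq {N : ℕ} (hN : 0 < N) (x y : ZMod N) :
    (((x + y).val : ℕ) : ℤ) ≡ (x.val : ℤ) + (y.val : ℤ) [ZMOD N] := by
  have : NeZero N := ⟨hN.ne'⟩
  rw [ZMod.val_add]
  push_cast
  exact Int.mod_modEq _ _

section

variable {n : ℕ} {m : Fin (n + 1) → ℕ} {K : Type*} [Field K] {ζ : Kˣ}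

theorem abelianCocycleFun_add_left (hpos : ∀ i, 0 < m i) (hdvd : ∀ i j, i ≤ j → m i ∣ m j)
    (hζ : IsPrimitiveRoot ζ (m (Fin.last n))) (a : Fin (n + 1) → Fin (n + 1) → ℤ)
    (x x' y : ∀ i, ZMod (m i)) :
    abelianCocycleFun m ζ a (x + x') y =
      abelianCocycleFun m ζ a x y * abelianCocycleFun m ζ a x' y := by
  simp only [abelianCocycleFun, ← Finset.prod_mul_distrib]
  refine Finset.prod_congr rfl fun r _ => Finset.prod_congr rfl fun s hs => ?_
  have hη : (ζ ^ (m (Fin.last n) / m r)) ^ m r = 1 := by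
    rw [← pow_mul, Nat.div_mul_cancel (hdvd r _ (Fin.le_last r)), hζ.pow_eq_one]
  rw [← zpow_add]
  refine zpow_eq_of_intModEq hη ?_
  have h := (val_add_intModEq (hpos s) (x s) (x' s)).of_dvd
    (Int.natCast_dvd_natCast.2 (hdvd r s (Finset.mem_Ioi.1 hs).le))
  have h2 := ((h.mul_left (a r s)).mul_right ((y r).val : ℤ)).neg
  have h3 : ∀ {A B C : ℤ} {N : ℤ}, A ≡ B [ZMOD N] → B = C → A ≡ C [ZMOD N] :=
    fun h e => e ▸ h
  exact h3 h2 (by ring)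

theorem abelianCocycleFun_add_right (hpos : ∀ i, 0 < m i) (hdvd : ∀ i j, i ≤ j → m i ∣ m j)
    (hζ : IsPrimitiveRoot ζ (m (Fin.last n))) (a : Fin (n + 1) → Fin (n + 1) → ℤ)
    (x y y' : ∀ i, ZMod (m i)) :
    abelianCocycleFun m ζ a x (y + y') =
      abelianCocycleFun m ζ a x y * abelianCocycleFun m ζ a x y' := by
  simp only [abelianCocycleFun, ← Finset.prod_mul_distrib]
  refine Finset.prod_congr rfl fun r _ => Finset.prod_congr rfl fun s hs => ?_
  have hη : (ζ ^ (m (Fin.last n) / m r)) ^ m r = 1 := by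
    rw [← pow_mul, Nat.div_mul_cancel (hdvd r _ (Fin.le_last r)), hζ.pow_eq_one]
  rw [← zpow_add]
  refine zpow_eq_of_intModEq hη ?_
  have h := val_add_intModEq (hpos r) (y r) (y' r)
  have h2 := (h.mul_left (a r s * ((x s).val : ℤ))).neg
  have h3 : ∀ {A B C : ℤ} {N : ℤ}, A ≡ B [ZMOD N] → B = C → A ≡ C [ZMOD N] :=
    fun h e => e ▸ h
  exact h3 h2 (by ring)

end

/-- The explicit normalized 2-cocycle with parameters `a_{rs}`, `r < s`, on the group
`ℤ/m_1 × ⋯ × ℤ/m_l` with `m_1 ∣ ⋯ ∣ m_l` (here `l = n + 1`). -/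
def abelianCocycle {n : ℕ} (m : Fin (n + 1) → ℕ) (hpos : ∀ i, 0 < m i)
    (hdvd : ∀ i j, i ≤ j → m i ∣ m j) {K : Type*} [Field K] (ζ : Kˣ)
    (hζ : IsPrimitiveRoot ζ (m (Fin.last n))) (a : Fin (n + 1) → Fin (n + 1) → ℤ) :
    NormalizedTwoCocycle (∀ i, ZMod (m i)) K where
  toFun := abelianCocycleFun m ζ a
  cocycle x y z := by
    rw [abelianCocycleFun_add_left hpos hdvd hζ, abelianCocycleFun_add_right hpos hdvd hζ]
    rw [mul_comm (abelianCocycleFun m ζ a x y), ← mul_assoc,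
      mul_comm (abelianCocycleFun m ζ a y z)]
  zero_left x := by simp [abelianCocycleFun]
  zero_right x := by simp [abelianCocycleFun]

/-- The antisymmetric integer matrix `B` with `b_{ij} = (m_l / m_i) a_{ij}` for `i < j`. -/
def parameterMatrix {n : ℕ} (m : Fin (n + 1) → ℕ) (a : Fin (n + 1) → Fin (n + 1) → ℤ) :
    Matrix (Fin (n + 1)) (Fin (n + 1)) ℤ :=
  Matrix.of fun i j =>
    if i < j then ((m (Fin.last n) / m i : ℕ) : ℤ) * a i j
    else if j < i then -(((m (Fin.last n) / m j : ℕ) : ℤ) * a j i)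
    else 0

/-- The `l × l` diagonal matrix `diag(c_1, …, c_k, 0, …, 0)`. -/
def paddedDiagonal (l : ℕ) {k : ℕ} (c : Fin k → ℕ) : Matrix (Fin l) (Fin l) ℤ :=
  Matrix.diagonal fun i => if h : (i : ℕ) < k then (c ⟨i, h⟩ : ℤ) else 0

/-- `c_1 ∣ ⋯ ∣ c_k` are the (positive) invariant factors of the integer matrix `B`: the Smith
normal form of `B` is `diag(c_1, …, c_k, 0, …, 0)`. -/
def IsInvariantFactors {l : ℕ} (B : Matrix (Fin l) (Fin l) ℤ) {k : ℕ} (c : Fin k → ℕ) : Prop :=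
  k ≤ l ∧ (∀ i, 0 < c i) ∧ (∀ i j, i ≤ j → c i ∣ c j) ∧
    ∃ P Q : (Matrix (Fin l) (Fin l) ℤ)ˣ,
      B = (P : Matrix (Fin l) (Fin l) ℤ) * paddedDiagonal l c * (Q : Matrix (Fin l) (Fin l) ℤ)

/-! ### Projective representations of a finite abelian group: Schur's lemma, traces, existence. -/

namespace ProjectiveRep

section

variable {G : Type*} [AddCommGroup G] {K : Type*} [Field K] {ω : NormalizedTwoCocycle G K}
  {V : Type*} [AddCommGroup V] [Module K V]

/-! For irreducible `ρ` of dimension `d`, averaging over `G` and Schur's lemma give `∑ x, tr ρ(x) ·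
tr ρ(x)⁻¹ = |G|`. Conjugation by `ρ(y)` multiplies `ρ(x)` by `ω(y,x)/ω(x,y)`, so the trace vanishes
off `G₀`; on `G₀` each `ρ(x)` is scalar and contributes `d²`. Hence `d² |G₀| = |G|`
(`IsIrreducible.finrank_sq_mul_card`).

It remains to find the index of `G₀`. Pulled back to `ℤ^l`, the commutator `ω(x,y)/ω(y,x)` is `ζ ^
(xᵀ B y)`, so `G₀` lifts to the `x` with `m_l ∣ xᵀ B y` for all `y`. Smith normal form decouples
this into the conditions `m_l ∣ λ_i x_i`, each of index `m_l / (m_l, λ_i)`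
(`index_regularSubgroup`). Existence comes from a minimal invariant subspace of the twisted regular
representation. -/

theorem IsIrreducible.finite [Finite G] {ρ : ProjectiveRep ω V} (hρ : ρ.IsIrreducible) :
    Module.Finite K V := by
  obtain ⟨hV, hρ⟩ := hρ
  obtain ⟨v, hv⟩ := exists_ne (0 : V)
  have hmem (x : G) : ρ.toFun x v ∈ Submodule.span K (Set.range fun x => ρ.toFun x v) :=
    Submodule.subset_span ⟨x, rfl⟩
  have hinv : ∀ x : G, ∀ w ∈ Submodule.span K (Set.range fun x => ρ.toFun x v),
      ρ.toFun x w ∈ Submodule.span K (Set.range fun x => ρ.toFun x v) := by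
    intro x w hw
    induction hw using Submodule.span_induction with
    | mem w hw =>
      obtain ⟨y, rfl⟩ := hw
      simp only [ρ.map_mul]
      exact Submodule.smul_mem _ _ (hmem _)
    | zero => simp
    | add u w _ _ hu hw => rw [map_add]; exact Submodule.add_mem _ hu hw
    | smul c w _ hw => rw [map_smul]; exact Submodule.smul_mem _ _ hw
  rcases hρ _ hinv with h | h
  · refine absurd ?_ hv
    have := hmem 0
    rwa [h, Submodule.mem_bot, ρ.map_zero] at this
  · exact ⟨h ▸ Submodule.fg_span (Set.finite_range _)⟩

/-- Schur's lemma for projective representations. -/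
theorem IsIrreducible.exists_eq_smul_of_commute [IsAlgClosed K] [FiniteDimensional K V]
    {ρ : ProjectiveRep ω V} (hρ : ρ.IsIrreducible) (T : V →ₗ[K] V)
    (hT : ∀ x v, T (ρ.toFun x v) = ρ.toFun x (T v)) : ∃ c : K, ∀ v, T v = c • v := by
  have := hρ.1
  obtain ⟨c, hc⟩ := Module.End.exists_eigenvalue T
  refine ⟨c, fun v => ?_⟩
  rcases hρ.2 (Module.End.eigenspace T c) (fun x v hv => by
    rw [Module.End.mem_eigenspace_iff] at hv ⊢
    rw [hT, hv, map_smul]) with h | h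
  · exact absurd h hc
  · exact Module.End.mem_eigenspace_iff.1 (h ▸ Submodule.mem_top)

/-- The inverse scalar here cancels the one from `map_mul`, so conjugation by `ρ` is an honest
action of `G`. -/
theorem map_mul_symm (ρ : ProjectiveRep ω V) (x y : G) (v : V) :
    (ρ.toFun x).symm ((ρ.toFun y).symm v) =
      ((ω.toFun y x)⁻¹ : Kˣ) • (ρ.toFun (y + x)).symm v := by
  rw [LinearEquiv.symm_apply_eq, LinearEquiv.symm_apply_eq]
  simp only [Units.smul_def, map_smul]
  rw [ρ.map_mul, smul_smul]
  simp

/-- The average of an endomorphism over the conjugation action of `G`. -/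
theorem average_commute [Fintype G] (ρ : ProjectiveRep ω V) (M : V →ₗ[K] V) (y : G) (v : V) :
    (∑ x, ρ.toFun x (M ((ρ.toFun x).symm (ρ.toFun y v)))) =
      ρ.toFun y (∑ x, ρ.toFun x (M ((ρ.toFun x).symm v))) := by
  obtain ⟨w, rfl⟩ := (ρ.toFun y).symm.surjective v
  rw [LinearEquiv.apply_symm_apply, map_sum]
  simp only [map_mul_symm, ρ.map_mul, Units.smul_def, map_smul, smul_smul]
  simp only [Units.inv_mul, one_smul]
  exact (Fintype.sum_equiv (Equiv.addLeft y) _ _ fun x => rfl).symm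

theorem trace_eq_zero [FiniteDimensional K V] (ρ : ProjectiveRep ω V) {x : G}
    (hx : x ∉ ω.regularElements) : LinearMap.trace K V (ρ.toFun x).toLinearMap = 0 := by
  simp only [NormalizedTwoCocycle.regularElements, Set.mem_ofPred_eq, not_forall] at hx
  obtain ⟨y, hy⟩ := hx
  have h : (ω.toFun y x : K) • (ρ.toFun x).toLinearMap =
      (ω.toFun x y : K) • (ρ.toFun y).conj (ρ.toFun x).toLinearMap := by
    ext v
    obtain ⟨v, rfl⟩ := (ρ.toFun y).surjective v
    simp only [LinearMap.smul_apply, LinearEquiv.coe_coe, LinearEquiv.conj_apply_apply,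
      LinearEquiv.symm_apply_apply, ρ.map_mul, smul_smul]
    rw [mul_comm, add_comm]
  have h2 := congrArg (LinearMap.trace K V) h
  rw [map_smul, map_smul, LinearMap.trace_conj', smul_eq_mul, smul_eq_mul, ← sub_eq_zero,
    ← sub_mul] at h2
  exact (mul_eq_zero.1 h2).resolve_left
    (sub_ne_zero.2 fun h => hy (Units.ext h.symm))

theorem IsIrreducible.exists_eq_smul [IsAlgClosed K] [FiniteDimensional K V]
    {ρ : ProjectiveRep ω V} (hρ : ρ.IsIrreducible) {x : G} (hx : x ∈ ω.regularElements) :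
    ∃ c : K, ∀ v, ρ.toFun x v = c • v :=
  hρ.exists_eq_smul_of_commute (ρ.toFun x).toLinearMap fun y v => by
    simp only [LinearEquiv.coe_coe, ρ.map_mul]
    rw [hx y, add_comm]

theorem IsIrreducible.trace_mul_trace_symm [IsAlgClosed K] [FiniteDimensional K V]
    {ρ : ProjectiveRep ω V} (hρ : ρ.IsIrreducible) {x : G} (hx : x ∈ ω.regularElements) :
    LinearMap.trace K V (ρ.toFun x).toLinearMap *
      LinearMap.trace K V (ρ.toFun x).symm.toLinearMap = (Module.finrank K V : K) ^ 2 := by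
  obtain ⟨c, hc⟩ := hρ.exists_eq_smul hx
  have := hρ.1
  have hc0 : c ≠ 0 := by
    rintro rfl
    obtain ⟨v, hv⟩ := exists_ne (0 : V)
    exact hv ((ρ.toFun x).injective (by rw [hc, zero_smul, LinearEquiv.map_zero]))
  have h1 : (ρ.toFun x).toLinearMap = c • LinearMap.id := by
    ext v; simp [hc]
  have h2 : (ρ.toFun x).symm.toLinearMap = c⁻¹ • LinearMap.id := by
    ext v
    simp [LinearEquiv.symm_apply_eq, hc, smul_smul, hc0]
  rw [h1, h2, map_smul, map_smul, LinearMap.trace_id, smul_eq_mul, smul_eq_mul]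
  field_simp

/-- The average of a rank-one map is scalar by Schur, and its trace determines the scalar; this
gives orthogonality of diagonal matrix coefficients. -/
theorem IsIrreducible.sum_trace_mul_trace_symm [IsAlgClosed K] [CharZero K] [Fintype G]
    [FiniteDimensional K V] {ρ : ProjectiveRep ω V} (hρ : ρ.IsIrreducible) :
    ∑ x, LinearMap.trace K V (ρ.toFun x).toLinearMap *
      LinearMap.trace K V (ρ.toFun x).symm.toLinearMap = Fintype.card G := by
  classical
  have := hρ.1
  have hd : (Module.finrank K V : K) ≠ 0 := Nat.cast_ne_zero.2 Module.finrank_pos.ne'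
  let b := Module.finBasis K V
  have key (i j : Fin (Module.finrank K V)) :
      ∑ x, b.repr (ρ.toFun x (b i)) i * b.repr ((ρ.toFun x).symm (b j)) j =
        if i = j then (Fintype.card G : K) / Module.finrank K V else 0 := by
    -- The elementary matrix sending `b j` to `b i`, of trace `δ_ij`.
    let M : V →ₗ[K] V := (b.coord j).smulRight (b i)
    let T : V →ₗ[K] V := ∑ x, (ρ.toFun x).conj M
    have hTv (v : V) : T v = ∑ x, ρ.toFun x (M ((ρ.toFun x).symm v)) := by
      simp [T, LinearMap.sum_apply, LinearEquiv.conj_apply_apply]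
    obtain ⟨c, hc⟩ := hρ.exists_eq_smul_of_commute T fun y v => by
      rw [hTv, hTv, ρ.average_commute]
    have htr : LinearMap.trace K V T = if i = j then (Fintype.card G : K) else 0 := by
      simp only [T, map_sum, LinearMap.trace_conj', M, LinearMap.trace_smulRight]
      simp [Finsupp.single_apply]
    have hT : T = c • LinearMap.id := by ext v; simp [hc]
    rw [hT, map_smul, LinearMap.trace_id, smul_eq_mul] at htr
    -- The `i`-th coordinate of `T (b j) = c • b j` is the sum sought.
    have h := congrArg (fun v => b.repr v i) ((hTv (b j)).symm.trans (hc (b j)))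
    simp only [M, LinearMap.smulRight_apply, map_smul, map_sum, Finsupp.coe_finsetSum,
      Finset.sum_apply, Finsupp.smul_apply, smul_eq_mul, Module.Basis.repr_self,
      Module.Basis.coord_apply, Finsupp.single_apply] at h
    simp only [mul_comm (b.repr (ρ.toFun _ (b i)) i)]
    rw [h]
    split_ifs at htr ⊢ with h1 h2 h2
    · rw [mul_one, eq_div_iff hd, htr]
    · exact absurd h1.symm h2
    · exact absurd h2.symm h1
    · simp
  simp only [LinearMap.trace_eq_matrix_trace K b, Matrix.trace, Matrix.diag_apply,
    LinearMap.toMatrix_apply, LinearEquiv.coe_coe, Finset.sum_mul_sum]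
  rw [Finset.sum_comm]
  simp only [Finset.sum_comm (s := (Finset.univ : Finset G)), key]
  simp only [Finset.sum_ite_eq, Finset.mem_univ, if_true, Finset.sum_const, Finset.card_univ,
    Fintype.card_fin, nsmul_eq_mul]
  field_simp

/-- The square of the degree of an irreducible projective representation of a finite abelian group
is the index of the set of regular elements. -/
theorem IsIrreducible.finrank_sq_mul_card [IsAlgClosed K] [CharZero K] [Finite G]
    {ρ : ProjectiveRep ω V} (hρ : ρ.IsIrreducible) :
    Module.finrank K V ^ 2 * Nat.card ω.regularElements = Nat.card G := by
  classical
  have := hρ.finite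
  have := Fintype.ofFinite G
  have h := hρ.sum_trace_mul_trace_symm
  rw [← Finset.sum_subset (Finset.subset_univ (Finset.univ.filter (· ∈ ω.regularElements)))
    (fun x _ hx => by rw [ρ.trace_eq_zero (by simpa using hx), zero_mul]),
    Finset.sum_congr rfl (fun x hx => hρ.trace_mul_trace_symm (Finset.mem_filter.1 hx).2),
    Finset.sum_const, nsmul_eq_mul] at h
  rw [Nat.card_eq_fintype_card, Nat.card_eq_fintype_card, Fintype.card_subtype, mul_comm]
  exact_mod_cast h

/-- The twisted regular representation on functions `G → K`. -/
def regular (ω : NormalizedTwoCocycle G K) : ProjectiveRep ω (G → K) where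
  toFun x :=
    { toFun := fun f z => (ω.toFun x (z - x) : K) * f (z - x)
      invFun := fun f z => ((ω.toFun x z)⁻¹ : Kˣ) * f (z + x)
      map_add' := fun f g => by ext z; simp [mul_add]
      map_smul' := fun c f => by ext z; simp [mul_left_comm]
      left_inv := fun f => by ext z; simp
      right_inv := fun f => by ext z; simp }
  map_zero f := by ext z; simp [ω.zero_left]
  map_mul x y f := by
    ext z
    have h := congrArg (Units.val) (ω.cocycle x y (z - x - y))
    rw [add_sub_cancel, Units.val_mul, Units.val_mul, sub_sub] at h
    simp only [LinearEquiv.coe_mk, LinearMap.coe_mk, AddHom.coe_mk, Pi.smul_apply, smul_eq_mul,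
      sub_sub, ← mul_assoc]
    rw [mul_comm (ω.toFun x y : K), ← h, mul_comm (ω.toFun y _ : K)]

/-- The restriction of a projective representation to an invariant subspace. -/
noncomputable def restrict [FiniteDimensional K V] (ρ : ProjectiveRep ω V) (W : Submodule K V)
    (hW : ∀ x, ∀ v ∈ W, ρ.toFun x v ∈ W) : ProjectiveRep ω W where
  -- In finite dimension injectivity suffices, so stability under inverses need not be assumed.
  toFun x := LinearEquiv.ofInjectiveEndo ((ρ.toFun x).toLinearMap.restrict (hW x))
    fun _ _ h => Subtype.ext ((ρ.toFun x).injective (congrArg Subtype.val h))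
  map_zero v := Subtype.ext (ρ.map_zero v)
  map_mul x y v := Subtype.ext (ρ.map_mul x y v)

/-- Transport of a projective representation along a linear equivalence. -/
def transport {W : Type*} [AddCommGroup W] [Module K W] (ρ : ProjectiveRep ω V)
    (e : V ≃ₗ[K] W) : ProjectiveRep ω W where
  toFun x := (e.symm.trans (ρ.toFun x)).trans e
  map_zero v := by simp [ρ.map_zero]
  map_mul x y v := by simp [ρ.map_mul]

theorem IsIrreducible.transport {W : Type*} [AddCommGroup W] [Module K W]
    {ρ : ProjectiveRep ω V} (hρ : ρ.IsIrreducible) (e : V ≃ₗ[K] W) :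
    (ρ.transport e).IsIrreducible := by
  have := hρ.1
  refine ⟨e.symm.toEquiv.nontrivial, fun U hU => ?_⟩
  have hU' := hρ.2 (U.comap e.toLinearMap) fun x v hv => by
    have := hU x (e v) hv
    simpa [ProjectiveRep.transport] using this
  have hUmap : (U.comap e.toLinearMap).map e.toLinearMap = U :=
    Submodule.map_comap_eq_of_surjective e.surjective U
  rcases hU' with h | h
  · left; rw [← hUmap, h, Submodule.map_bot]
  · right; rw [← hUmap, h, Submodule.map_top, LinearMap.range_eq_top.2 e.surjective]

theorem exists_invariant_irreducible [FiniteDimensional K V] [Nontrivial V]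
    (ρ : ProjectiveRep ω V) :
    ∃ (W : Submodule K V) (hW : ∀ x, ∀ v ∈ W, ρ.toFun x v ∈ W),
      (ρ.restrict W hW).IsIrreducible := by
  let S : Set (Submodule K V) := {W | W ≠ ⊥ ∧ ∀ x, ∀ v ∈ W, ρ.toFun x v ∈ W}
  have hS : S.Nonempty := ⟨⊤, top_ne_bot, fun _ _ _ => Submodule.mem_top⟩
  obtain ⟨W, ⟨hW0, hW⟩, hmin⟩ := wellFounded_lt.has_min S hS
  refine ⟨W, hW, (Submodule.nontrivial_iff_ne_bot).2 hW0, fun U hU => ?_⟩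
  by_cases hU0 : U = ⊥
  · exact Or.inl hU0
  right
  have hmap : U.map W.subtype ∈ S := by
    refine ⟨fun h => hU0 (Submodule.map_injective_of_injective W.injective_subtype (h.trans (Submodule.map_bot _).symm)), ?_⟩
    rintro x _ ⟨u, hu, rfl⟩
    exact ⟨_, hU x u hu, rfl⟩
  have hle : U.map W.subtype ≤ W := Submodule.map_subtype_le W U
  have heq : U.map W.subtype = W := by
    by_contra hne
    exact hmin _ hmap (lt_of_le_of_ne hle hne)
  rw [eq_top_iff]
  rintro ⟨w, hw'⟩ -
  have hw := hw'
  rw [← heq] at hw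
  obtain ⟨u, hu, hu'⟩ := hw
  rwa [← show u = ⟨w, hw'⟩ from Subtype.ext hu']

theorem exists_isIrreducible [Finite G] (ω : NormalizedTwoCocycle G K) :
    ∃ (d : ℕ) (ρ : ProjectiveRep ω (Fin d → K)), ρ.IsIrreducible := by
  have := Fintype.ofFinite G
  obtain ⟨W, hW, h⟩ := (regular ω).exists_invariant_irreducible
  exact ⟨_, _, h.transport (Module.finBasis K W).equivFun⟩

end

end ProjectiveRep

/-! ### Index of the regular elements via Smith normal form. -/

section

open Matrix

/-- `N ∣ x_i D_i` means `N / gcd(N, D_i) ∣ x_i`, so `H` is the kernel of a surjection onto a product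
of cyclic groups. -/
theorem index_setOf_forall_dvd_mul {l : ℕ} (N : ℕ) (hN : 0 < N) (D : Fin l → ℕ)
    (H : AddSubgroup (Fin l → ℤ)) (hH : ∀ x, x ∈ H ↔ ∀ i, (N : ℤ) ∣ x i * D i) :
    H.index = ∏ i, N / Nat.gcd N (D i) := by
  let φ : (Fin l → ℤ) →+ (∀ i, ZMod (N / Nat.gcd N (D i))) :=
    AddMonoidHom.pi fun i =>
      (Int.castAddHom (ZMod (N / Nat.gcd N (D i)))).comp (Pi.evalAddMonoidHom _ i)
  have hφ : Function.Surjective φ := fun y =>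
    ⟨fun i => (ZMod.intCast_surjective (y i)).choose,
      funext fun i => (ZMod.intCast_surjective (y i)).choose_spec⟩
  have hker : H = φ.ker := by
    ext x
    rw [hH, AddMonoidHom.mem_ker, funext_iff]
    refine forall_congr' fun i => ?_
    change _ ↔ ((x i : ℤ) : ZMod (N / Nat.gcd N (D i))) = 0
    rw [ZMod.intCast_zmod_eq_zero_iff_dvd]
    have hg : 0 < Nat.gcd N (D i) := Nat.gcd_pos_of_pos_left _ hN
    have hN' : (N : ℤ) = ((N / Nat.gcd N (D i) : ℕ) : ℤ) * (Nat.gcd N (D i) : ℕ) := by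
      exact_mod_cast (Nat.div_mul_cancel (Nat.gcd_dvd_left N (D i))).symm
    have hD' : (D i : ℤ) = ((D i / Nat.gcd N (D i) : ℕ) : ℤ) * (Nat.gcd N (D i) : ℕ) := by
      exact_mod_cast (Nat.div_mul_cancel (Nat.gcd_dvd_right N (D i))).symm
    have hcop : IsCoprime ((N / Nat.gcd N (D i) : ℕ) : ℤ) ((D i / Nat.gcd N (D i) : ℕ) : ℤ) :=
      Nat.isCoprime_iff_coprime.2 (Nat.coprime_div_gcd_div_gcd hg)
    constructor
    · intro h
      refine hcop.dvd_of_dvd_mul_right ((mul_dvd_mul_iff_right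
        (Int.natCast_ne_zero.2 hg.ne')).1 ?_)
      rwa [mul_assoc, ← hD', ← hN']
    · intro h
      rw [hN', hD', ← mul_assoc]
      exact mul_dvd_mul_right (h.mul_right _) _
  rw [hker, AddSubgroup.index_ker, AddMonoidHom.range_eq_top.2 hφ, AddSubgroup.card_top,
    Nat.card_pi]
  simp

/-- Padding zeros contribute `N / gcd(N, 0) = 1`. -/
theorem prod_div_gcd_dite {l k : ℕ} (hk : k ≤ l) (N : ℕ) (hN : 0 < N) (c : Fin k → ℕ) :
    ∏ i : Fin l, N / Nat.gcd N (if h : (i : ℕ) < k then c ⟨i, h⟩ else 0) =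
      ∏ i, N / Nat.gcd N (c i) := by
  obtain ⟨t, rfl⟩ := Nat.exists_eq_add_of_le hk
  rw [Fin.prod_univ_add]
  simp [Nat.div_self hN]

/-- The unimodular changes of variable `x ↦ x P⁻¹` and `y ↦ Q y` preserve the index and make the
form diagonal. -/
theorem index_of_mem_iff_forall_dvd_dotProduct {l k : ℕ} (N : ℕ) (hN : 0 < N)
    {B : Matrix (Fin l) (Fin l) ℤ} {c : Fin k → ℕ} (hc : IsInvariantFactors B c)
    (H : AddSubgroup (Fin l → ℤ)) (hH : ∀ x, x ∈ H ↔ ∀ y, (N : ℤ) ∣ x ⬝ᵥ B *ᵥ y) :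
    H.index = ∏ i, N / Nat.gcd N (c i) := by
  obtain ⟨hk, -, -, P, Q, hB⟩ := hc
  let e : (Fin l → ℤ) →+ (Fin l → ℤ) :=
    (Matrix.vecMulLinear ((P⁻¹ : (Matrix (Fin l) (Fin l) ℤ)ˣ) : Matrix _ _ ℤ)).toAddMonoidHom
  have he (x) : e x = x ᵥ* ((P⁻¹ : (Matrix (Fin l) (Fin l) ℤ)ˣ) : Matrix _ _ ℤ) := rfl
  have hsurj : Function.Surjective e := fun x =>
    ⟨x ᵥ* (P : Matrix _ _ ℤ), by rw [he, vecMul_vecMul, Units.mul_inv, vecMul_one]⟩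
  rw [← AddSubgroup.index_comap_of_surjective H hsurj, ← prod_div_gcd_dite hk N hN c]
  refine index_setOf_forall_dvd_mul N hN _ _ fun x => ?_
  have hform (y) : e x ⬝ᵥ B *ᵥ y = x ⬝ᵥ paddedDiagonal l c *ᵥ ((Q : Matrix _ _ ℤ) *ᵥ y) := by
    rw [he, hB, ← mulVec_mulVec, ← mulVec_mulVec, dotProduct_mulVec, vecMul_vecMul,
      Units.inv_mul, vecMul_one]
  have hdiag (z : Fin l → ℤ) : x ⬝ᵥ paddedDiagonal l c *ᵥ z =
      ∑ i, x i * ((if h : (i : ℕ) < k then c ⟨i, h⟩ else 0 : ℕ) : ℤ) * z i := by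
    simp only [paddedDiagonal, dotProduct, mulVec_diagonal, mul_assoc]
    refine Finset.sum_congr rfl fun i _ => ?_
    split_ifs <;> simp
  rw [AddSubgroup.mem_comap, hH]
  simp only [hform, hdiag]
  constructor
  · intro h i
    -- Testing on `Q⁻¹ e_i` isolates the `i`-th diagonal condition.
    have := h (((Q⁻¹ : (Matrix (Fin l) (Fin l) ℤ)ˣ) : Matrix _ _ ℤ) *ᵥ Pi.single i 1)
    rw [mulVec_mulVec, Units.mul_inv, one_mulVec] at this
    simpa [Pi.single_apply] using this
  · intro h y
    exact Finset.dvd_sum fun i _ => (h i).mul_right _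

variable {n : ℕ} {m : Fin (n + 1) → ℕ} {K : Type*} [Field K] {ζ : Kˣ}

/-- The strictly upper triangular part of `parameterMatrix`. -/
def upperParameterMatrix (m : Fin (n + 1) → ℕ) (a : Fin (n + 1) → Fin (n + 1) → ℤ) :
    Matrix (Fin (n + 1)) (Fin (n + 1)) ℤ :=
  Matrix.of fun i j => if i < j then ((m (Fin.last n) / m i : ℕ) : ℤ) * a i j else 0

theorem parameterMatrix_eq_sub_transpose (m : Fin (n + 1) → ℕ)
    (a : Fin (n + 1) → Fin (n + 1) → ℤ) :
    parameterMatrix m a = upperParameterMatrix m a - (upperParameterMatrix m a)ᵀ := by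
  ext i j
  simp only [parameterMatrix, upperParameterMatrix, of_apply, Matrix.sub_apply,
    transpose_apply]
  rcases lt_trichotomy i j with h | h | h
  · simp [h, h.not_gt]
  · simp [h]
  · simp [h, h.not_gt]

/-- Reduction of an integer vector modulo the `m i`. -/
def reductionHom (m : Fin (n + 1) → ℕ) : (Fin (n + 1) → ℤ) →+ (∀ i, ZMod (m i)) :=
  AddMonoidHom.pi fun i => (Int.castAddHom (ZMod (m i))).comp (Pi.evalAddMonoidHom _ i)

theorem reductionHom_surjective (m : Fin (n + 1) → ℕ) :
    Function.Surjective (reductionHom m) := fun y =>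
  ⟨fun i => (ZMod.intCast_surjective (y i)).choose,
    funext fun i => (ZMod.intCast_surjective (y i)).choose_spec⟩

theorem val_intCast_intModEq {N : ℕ} (hN : 0 < N) (x : ℤ) :
    (((x : ZMod N).val : ℕ) : ℤ) ≡ x [ZMOD N] := by
  have : NeZero N := ⟨hN.ne'⟩
  rw [ZMod.val_intCast]
  exact Int.mod_modEq _ _

/-- The exponent of `ζ_{m_r}` matters only modulo `m_r`, and `m_r ∣ m_s`, so any integer lifts may
replace the standard representatives. -/
theorem abelianCocycleFun_reductionHom (hpos : ∀ i, 0 < m i) (hdvd : ∀ i j, i ≤ j → m i ∣ m j)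
    (hζ : IsPrimitiveRoot ζ (m (Fin.last n))) (a : Fin (n + 1) → Fin (n + 1) → ℤ)
    (x y : Fin (n + 1) → ℤ) :
    abelianCocycleFun m ζ a (reductionHom m x) (reductionHom m y) =
      ζ ^ (-(y ⬝ᵥ upperParameterMatrix m a *ᵥ x)) := by
  have hterm (r s : Fin (n + 1)) (hs : r < s) :
      (ζ ^ (m (Fin.last n) / m r)) ^
        (-(a r s * ((reductionHom m x s).val : ℤ) * ((reductionHom m y r).val : ℤ))) =
      ζ ^ (-(y r * (upperParameterMatrix m a r s * x s))) := by
    have hη : (ζ ^ (m (Fin.last n) / m r)) ^ m r = 1 := by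
      rw [← pow_mul, Nat.div_mul_cancel (hdvd r _ (Fin.le_last r)), hζ.pow_eq_one]
    have hxs : (((reductionHom m x s).val : ℕ) : ℤ) ≡ x s [ZMOD m r] :=
      (val_intCast_intModEq (hpos s) (x s)).of_dvd (Int.natCast_dvd_natCast.2 (hdvd r s hs.le))
    have hyr : (((reductionHom m y r).val : ℕ) : ℤ) ≡ y r [ZMOD m r] :=
      val_intCast_intModEq (hpos r) (y r)
    rw [zpow_eq_of_intModEq hη ((hxs.mul_left (a r s)).mul hyr).neg, ← zpow_natCast, ← _root_.zpow_mul]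
    congr 1
    simp only [upperParameterMatrix, of_apply, hs, if_true]
    ring
  have hprod {ι : Type} (t : Finset ι) (f : ι → ℤ) : ∏ i ∈ t, ζ ^ f i = ζ ^ ∑ i ∈ t, f i := by
    classical
    induction t using Finset.induction_on with
    | empty => simp
    | insert i t hi ih => rw [Finset.prod_insert hi, Finset.sum_insert hi, _root_.zpow_add, ih]
  have hsum : -(y ⬝ᵥ upperParameterMatrix m a *ᵥ x) =
      ∑ r, ∑ s ∈ Finset.Ioi r, -(y r * (upperParameterMatrix m a r s * x s)) := by
    simp only [dotProduct, mulVec, Finset.mul_sum, ← Finset.sum_neg_distrib]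
    refine Finset.sum_congr rfl fun r _ =>
      (Finset.sum_subset (Finset.subset_univ _) fun s _ hs => ?_).symm
    rw [Finset.mem_Ioi] at hs
    simp [upperParameterMatrix, hs]
  rw [hsum, ← hprod, abelianCocycleFun]
  refine Finset.prod_congr rfl fun r _ => ?_
  rw [← hprod]
  exact Finset.prod_congr rfl fun s hs => hterm r s (Finset.mem_Ioi.1 hs)

/-- With `U` the upper triangular part, `ω(x,y)/ω(y,x) = ζ ^ (xᵀ(U - Uᵀ)y)`; primitivity of `ζ`
turns triviality into divisibility. -/
theorem abelianCocycleFun_comm_iff (hpos : ∀ i, 0 < m i) (hdvd : ∀ i j, i ≤ j → m i ∣ m j)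
    (hζ : IsPrimitiveRoot ζ (m (Fin.last n))) (a : Fin (n + 1) → Fin (n + 1) → ℤ)
    (x y : Fin (n + 1) → ℤ) :
    abelianCocycleFun m ζ a (reductionHom m x) (reductionHom m y) =
        abelianCocycleFun m ζ a (reductionHom m y) (reductionHom m x) ↔
      (m (Fin.last n) : ℤ) ∣ x ⬝ᵥ parameterMatrix m a *ᵥ y := by
  rw [abelianCocycleFun_reductionHom hpos hdvd hζ, abelianCocycleFun_reductionHom hpos hdvd hζ,
    ← div_eq_one, div_eq_mul_inv, ← _root_.zpow_sub, hζ.zpow_eq_one_iff_dvd, parameterMatrix_eq_sub_transpose,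
    sub_mulVec, dotProduct_sub, mulVec_transpose, dotProduct_comm x (y ᵥ* _),
    ← dotProduct_mulVec, neg_sub_neg]

/-- The regular elements of `abelianCocycle` form a subgroup. -/
def regularSubgroup (hpos : ∀ i, 0 < m i) (hdvd : ∀ i j, i ≤ j → m i ∣ m j)
    (hζ : IsPrimitiveRoot ζ (m (Fin.last n))) (a : Fin (n + 1) → Fin (n + 1) → ℤ) :
    AddSubgroup (∀ i, ZMod (m i)) where
  carrier := (abelianCocycle m hpos hdvd ζ hζ a).regularElements
  zero_mem' y := by
    rw [NormalizedTwoCocycle.zero_left, NormalizedTwoCocycle.zero_right]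
  add_mem' {x x'} hx hx' y := by
    have h1 : abelianCocycleFun m ζ a x y = abelianCocycleFun m ζ a y x := hx y
    have h2 : abelianCocycleFun m ζ a x' y = abelianCocycleFun m ζ a y x' := hx' y
    change abelianCocycleFun m ζ a (x + x') y = abelianCocycleFun m ζ a y (x + x')
    rw [abelianCocycleFun_add_left hpos hdvd hζ, abelianCocycleFun_add_right hpos hdvd hζ, h1, h2]
  neg_mem' {x} hx y := by
    have h1 : abelianCocycleFun m ζ a x y = abelianCocycleFun m ζ a y x := hx y
    change abelianCocycleFun m ζ a (-x) y = abelianCocycleFun m ζ a y (-x)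
    have h2 := abelianCocycleFun_add_left hpos hdvd hζ a x (-x) y
    have h3 := abelianCocycleFun_add_right hpos hdvd hζ a y x (-x)
    rw [add_neg_cancel] at h2 h3
    have h4 : abelianCocycleFun m ζ a 0 y = abelianCocycleFun m ζ a y 0 := by
      simp [abelianCocycleFun]
    rw [h2, h3, h1] at h4
    exact mul_left_cancel h4

theorem index_regularSubgroup (hpos : ∀ i, 0 < m i) (hdvd : ∀ i j, i ≤ j → m i ∣ m j)
    (hζ : IsPrimitiveRoot ζ (m (Fin.last n))) (a : Fin (n + 1) → Fin (n + 1) → ℤ)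
    {k : ℕ} {c : Fin k → ℕ} (hc : IsInvariantFactors (parameterMatrix m a) c) :
    (regularSubgroup hpos hdvd hζ a).index =
      ∏ i, m (Fin.last n) / Nat.gcd (m (Fin.last n)) (c i) := by
  rw [← AddSubgroup.index_comap_of_surjective _ (reductionHom_surjective m)]
  refine index_of_mem_iff_forall_dvd_dotProduct _ (hpos _) hc _ fun x => ?_
  simp only [← abelianCocycleFun_comm_iff hpos hdvd hζ]
  exact (reductionHom_surjective m).forall

end

theorem mainTheorem7 {K : Type*} [Field K] [IsAlgClosed K] [CharZero K]
    {n : ℕ} (m : Fin (n + 1) → ℕ) (hpos : ∀ i, 0 < m i)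
    (hdvd : ∀ i j, i ≤ j → m i ∣ m j)
    (ζ : Kˣ) (hζ : IsPrimitiveRoot ζ (m (Fin.last n)))
    (a : Fin (n + 1) → Fin (n + 1) → ℤ)
    {k : ℕ} (c : Fin k → ℕ) (hc : IsInvariantFactors (parameterMatrix m a) c) :
    (Nat.card (abelianCocycle m hpos hdvd ζ hζ a).regularElements : ℚ) =
        (Nat.card (∀ i, ZMod (m i)) : ℚ) /
          (∏ i : Fin k, ((m (Fin.last n) : ℚ) / (Nat.gcd (m (Fin.last n)) (c i) : ℚ))) ∧
      ∃ d : ℕ,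
        (d : ℝ) = Real.sqrt
          (∏ i : Fin k, ((m (Fin.last n) : ℝ) / (Nat.gcd (m (Fin.last n)) (c i) : ℝ))) ∧
        (∃ ρ : ProjectiveRep (abelianCocycle m hpos hdvd ζ hζ a) (Fin d → K),
          ρ.IsIrreducible) ∧
        ∀ (V : Type*) [AddCommGroup V] [Module K V]
          (ρ : ProjectiveRep (abelianCocycle m hpos hdvd ζ hζ a) V),
          ρ.IsIrreducible → Module.Finite K V ∧ Module.finrank K V = d := by
  have (i : Fin (n + 1)) : NeZero (m i) := ⟨(hpos i).ne'⟩
  have hindex := index_regularSubgroup hpos hdvd hζ a hc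
  have hcard : Nat.card (abelianCocycle m hpos hdvd ζ hζ a).regularElements *
      (∏ i, m (Fin.last n) / Nat.gcd (m (Fin.last n)) (c i)) = Nat.card (∀ i, ZMod (m i)) := by
    rw [← hindex]
    exact (regularSubgroup hpos hdvd hζ a).card_mul_index
  have hG : 0 < Nat.card (∀ i, ZMod (m i)) := Nat.card_pos
  have hreg : 0 < Nat.card (abelianCocycle m hpos hdvd ζ hζ a).regularElements :=
    Nat.pos_of_mul_pos_right (hcard ▸ hG)
  have hprod : 0 < ∏ i, m (Fin.last n) / Nat.gcd (m (Fin.last n)) (c i) :=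
    Nat.pos_of_mul_pos_left (hcard ▸ hG)
  have hsq {V : Type _} [AddCommGroup V] [Module K V]
      {ρ : ProjectiveRep (abelianCocycle m hpos hdvd ζ hζ a) V} (hρ : ρ.IsIrreducible) :
      Module.finrank K V ^ 2 = ∏ i, m (Fin.last n) / Nat.gcd (m (Fin.last n)) (c i) :=
    -- Both sides times `|G₀|` equal `|G|`.
    Nat.eq_of_mul_eq_mul_right hreg (by rw [hρ.finrank_sq_mul_card, ← hcard, mul_comm])
  have hcast {F : Type} [Field F] [CharZero F] :
      ∏ i, ((m (Fin.last n) : F) / (Nat.gcd (m (Fin.last n)) (c i) : F)) =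
        ((∏ i, m (Fin.last n) / Nat.gcd (m (Fin.last n)) (c i) : ℕ) : F) := by
    rw [Nat.cast_prod]
    exact Finset.prod_congr rfl fun i _ => (Nat.cast_div_charZero (Nat.gcd_dvd_left _ _)).symm
  obtain ⟨d, ρ₀, hρ₀⟩ := ProjectiveRep.exists_isIrreducible (abelianCocycle m hpos hdvd ζ hζ a)
  have hd : d ^ 2 = ∏ i, m (Fin.last n) / Nat.gcd (m (Fin.last n)) (c i) := by
    have h := hρ₀.finrank_sq_mul_card
    rw [Module.finrank_fin_fun] at h
    exact Nat.eq_of_mul_eq_mul_right hreg (by rw [h, ← hcard, mul_comm])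
  refine ⟨?_, d, ?_, ⟨ρ₀, hρ₀⟩, fun V _ _ ρ hρ => ⟨hρ.finite, ?_⟩⟩
  · rw [hcast, eq_div_iff (Nat.cast_ne_zero.2 hprod.ne')]
    exact_mod_cast hcard
  · rw [hcast, ← hd, Nat.cast_pow, Real.sqrt_sq (Nat.cast_nonneg d)]
  · exact Nat.pow_left_injective two_ne_zero ((hsq hρ).trans hd.symm)
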